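/- Let $V:\mathbb R\to(-\infty,+\infty]$ be measurable, with weight $\rho=e^{-V}$ (so $\rho=0$ where $V=+\infty$), let $J\subset\mathbb R$ be a measurable set on which $\rho$ does not vanish almost everywhere, let $J^c=\mathbb R\setminus J$, and let $n\ge 1$. For a sequence of times $t=(t_1,t_2,\dots)$ put $V_t(x)=V(x)-\sum_{k\ge1}t_kx^k$ and $\rho_t(x)=e^{-V_t(x)}=e^{-V(x)+\sum_{k\ge 1}t_kx^k}$, and call $t$ admissible if the series converges absolutely for almost every $x$ with $V(x)<\infty$ and if $\rho_{t'}$ is integrable for all $t'$ that differ from $t$ only in the first entry, with $t_1'$ in some neighbourhood of $t_1$ (in particular all moments of $\rho_t$ are finite). For admissible $t$ let $\pi_k$ ($k=0,1,2,\dots$, depending on $t$) be the orthonormal polynomials of the weight $\rho_t$ on $\mathbb R$, with positive leading coefficients, let $\varphi_k=\pi_k\rho_t^{1/2}$, let $b_k=\int_{\mathbb R}x\varphi_k\varphi_{k+1}\,dx$ be the off-diagonal coefficients of the three-term recurrence $x\varphi_k=b_k\varphi_{k+1}+a_k\varphi_k+b_{k-1}\varphi_{k-1}$, and let $\varphi=\sqrt{b_{n-1}}\,\varphi_n$,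 $\psi=\sqrt{b_{n-1}}\,\varphi_{n-1}$. Let $K_n^J$ be the integral operator on $L^2(J^c)$ with the Christoffel--Darboux kernel $K_n(x,y)=\sum_{k=0}^{n-1}\varphi_k(x)\varphi_k(y)$, and let $$\tau_n^J(t)=\frac1{n!}\int_{J^n}\prod_{1\le i<j\le n}(x_j-x_i)^2\prod_{i=1}^n\rho_t(x_i)\,dx_i,\qquad \tau_n(t)=\tau_n^{\mathbb R}(t).$$ Then, for every admissible $t$, the operator $I-K_n^J$ is invertible, $\tau_n^J(t)>0$ and $\tau_n(t)>0$, the function $\ln(\tau_n^J/\tau_n)$ is differentiable in $t_1$ at $t$, and the inner product in $L^2(J^c)$ $$v_n(t)=(\varphi,(I-K_n^J)^{-1}\psi)=(\psi,(I-K_n^J)^{-1}\varphi)$$ satisfies $$v_n(t)=-\frac{\partial}{\partial t_1}\ln\frac{\tau_n^J(t)}{\tau_n(t)}.$$ In particular, if $t=0$ is admissible, then the quantity $v_n=(\varphi,(I-K_n^J)^{-1}\psi)=(\psi,(I-K_n^J)^{-1}\varphi)$ of the unmodified ensemble with weight $e^{-V}$ satisfies $$v_n=-\frac{\partial}{\partial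 t_1}\ln\frac{\tau_n^J(t)}{\tau_n(t)}\Big|_{t=0}.$$ -/

import Mathlib

open MeasureTheory Filter Topology Polynomial
open scoped RealInnerProductSpace Nat

noncomputable section

namespace UnitaryEnsemble

/-- The weight `e^{-V}` of a potential `V : ℝ → (-∞, +∞]`; it vanishes where `V = +∞`
(so that weights supported on a subset of the line are covered). -/
def weight (V : ℝ → EReal) (x : ℝ) : ℝ := (EReal.exp (-(V x))).toReal

/-- The Toda-deformed potential `V(x) - ∑_{k ≥ 1} t_k x^k`. -/
def toda (V : ℝ → EReal) (t : ℕ+ → ℝ) (x : ℝ) : EReal :=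
  V x - ((∑' k : ℕ+, t k * x ^ (k : ℕ) : ℝ) : EReal)

theorem toda_zero (V : ℝ → EReal) : toda V 0 = V := by
  funext x
  simp [toda]

theorem weight_toda {V : ℝ → EReal} (t : ℕ+ → ℝ) {x : ℝ} (hx : V x ≠ ⊥) :
    weight (toda V t) x = weight V x * Real.exp (∑' k : ℕ+, t k * x ^ (k : ℕ)) := by
  unfold weight toda
  generalize V x = v at hx
  generalize (∑' k : ℕ+, t k * x ^ (k : ℕ)) = r
  induction v with
  | bot => exact absurd rfl hx
  | top => simp
  | coe v =>
    rw [← EReal.coe_sub, ← EReal.coe_neg, ← EReal.coe_neg, EReal.exp_coe, EReal.exp_coe,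
      ENNReal.toReal_ofReal (Real.exp_pos _).le, ENNReal.toReal_ofReal (Real.exp_pos _).le,
      ← Real.exp_add]
    congr 1
    ring

/-- The deformation of the ensemble makes sense at the times `t` and for all nearby values of the
first time: the series `∑ t_k x^k` converges almost everywhere on the support of the weight, and
the deformed weight has finite total mass for all values of `t_1` in a neighbourhood of the given
one. -/
def Admissible (V : ℝ → EReal) (t : ℕ+ → ℝ) : Prop :=
  (∀ᵐ x : ℝ, V x ≠ ⊤ → Summable fun k : ℕ+ => t k * x ^ (k : ℕ)) ∧
    ∀ᶠ s in 𝓝 (t 1), Integrable (weight (toda V (Function.update t 1 s)))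

/-- The inner product `∫ p q e^{-V} dx` of two polynomials. -/
def polyInner (V : ℝ → EReal) (p q : ℝ[X]) : ℝ := ∫ x, p.eval x * q.eval x * weight V x

/-- The monic orthogonal polynomials of the weight `e^{-V}` (Gram-Schmidt on `1, x, x², …`). -/
def monicOP (V : ℝ → EReal) (n : ℕ) : ℝ[X] :=
  X ^ n - ∑ k : Fin n,
    C (polyInner V (X ^ n) (monicOP V k) / polyInner V (monicOP V k) (monicOP V k)) * monicOP V k
termination_by n
decreasing_by all_goals exact k.isLt

/-- The orthonormal polynomials `π_n`, with positive leading coefficients. -/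
def orthoPoly (V : ℝ → EReal) (n : ℕ) : ℝ[X] :=
  C (√(polyInner V (monicOP V n) (monicOP V n)))⁻¹ * monicOP V n

/-- The orthonormal functions `φ_n = π_n e^{-V/2}`. -/
def phi (V : ℝ → EReal) (n : ℕ) (x : ℝ) : ℝ := (orthoPoly V n).eval x * √(weight V x)

/-- The off-diagonal coefficient `b_n = ∫ x φ_n φ_{n+1} dx` of the three-term recurrence
`x φ_n = b_n φ_{n+1} + a_n φ_n + b_{n-1} φ_{n-1}`. -/
def recB (V : ℝ → EReal) (n : ℕ) : ℝ := ∫ x, x * phi V n x * phi V (n + 1) x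

/-- The Christoffel-Darboux kernel `K_n(x, y) = ∑_{k < n} φ_k(x) φ_k(y)`. -/
def kernel (V : ℝ → EReal) (n : ℕ) (x y : ℝ) : ℝ := ∑ k ∈ Finset.range n, phi V k x * phi V k y

/-- The real Hilbert space `L²(Jᶜ)`. -/
abbrev L2c (J : Set ℝ) : Type := Lp ℝ 2 (volume.restrict Jᶜ)

open Classical in
/-- The element of `L²(Jᶜ)` given by (the restriction of) a function `f : ℝ → ℝ`; zero if `f` is
not square integrable on `Jᶜ`. -/
def toL2c (J : Set ℝ) (f : ℝ → ℝ) : L2c J :=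
  if h : MemLp f 2 (volume.restrict Jᶜ) then h.toLp f else 0

/-- The integral operator `K_n^J` on `L²(Jᶜ)` with kernel `K_n(x, y)`, as a sum of rank one
operators `f ↦ (φ_k, f) φ_k`; see `opK_ae_eq` for the kernel. -/
def opK (V : ℝ → EReal) (J : Set ℝ) (n : ℕ) : L2c J →L[ℝ] L2c J :=
  ∑ k ∈ Finset.range n,
    (innerSL ℝ (toL2c J (phi V k))).smulRight (toL2c J (phi V k))

theorem toL2c_coeFn {J : Set ℝ} {f : ℝ → ℝ} (h : MemLp f 2 (volume.restrict Jᶜ)) :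
    toL2c J f =ᵐ[volume.restrict Jᶜ] f := by
  rw [toL2c, dif_pos h]
  exact h.coeFn_toLp

/-- `opK` is the integral operator with kernel `K_n(x, y)` on `L²(Jᶜ)`. -/
theorem opK_ae_eq (V : ℝ → EReal) (J : Set ℝ) (n : ℕ)
    (h : ∀ k < n, MemLp (phi V k) 2 (volume.restrict Jᶜ)) (f : L2c J) :
    opK V J n f =ᵐ[volume.restrict Jᶜ] fun x => ∫ y in Jᶜ, kernel V n x y * f y := by
  induction n with
  | zero =>
    simp only [opK, kernel, Finset.range_zero, Finset.sum_empty, zero_mul, integral_zero]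
    exact Lp.coeFn_zero _ _ _
  | succ n ih =>
    have ih' := ih fun k hk => h k (hk.trans (Nat.lt_succ_self n))
    have hs : opK V J (n + 1) f
        = opK V J n f + ⟪toL2c J (phi V n), f⟫ • toL2c J (phi V n) := by
      simp [opK, Finset.sum_range_succ]
    have hint : ∀ k < n + 1, Integrable (fun y => phi V k y * f y) (volume.restrict Jᶜ) :=
      fun k hk => (h k hk).integrable_mul (Lp.memLp f)
    have hin : ⟪toL2c J (phi V n), f⟫ = ∫ y in Jᶜ, phi V n y * f y := by
      rw [L2.inner_def]
      refine integral_congr_ae ?_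
      filter_upwards [toL2c_coeFn (h n (Nat.lt_succ_self n))] with y hy
      simp [hy, mul_comm]
    rw [hs]
    filter_upwards [ih', toL2c_coeFn (h n (Nat.lt_succ_self n)),
      Lp.coeFn_add (opK V J n f) (⟪toL2c J (phi V n), f⟫ • toL2c J (phi V n)),
      Lp.coeFn_smul ⟪toL2c J (phi V n), f⟫ (toL2c J (phi V n))] with x h1 h2 h3 h4
    rw [h3, Pi.add_apply, h4, Pi.smul_apply, h1, h2, hin, smul_eq_mul, ← integral_mul_const,
      ← integral_add]
    · refine integral_congr_ae (Eventually.of_forall fun y => ?_)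
      simp only [kernel, Finset.sum_range_succ]
      ring
    · simp only [kernel, Finset.sum_mul]
      refine integrable_finsetSum _ fun k hk => ?_
      have := (hint k ((Finset.mem_range.1 hk).trans (Nat.lt_succ_self n))).const_mul (phi V k x)
      simpa only [mul_assoc] using this
    · exact (hint n (Nat.lt_succ_self n)).mul_const _

/-- `φ = √b_{n-1} φ_n`, as an element of `L²(Jᶜ)` (for `n ≥ 1`). -/
def bigPhi (V : ℝ → EReal) (J : Set ℝ) (n : ℕ) : L2c J :=
  toL2c J fun x => √(recB V (n - 1)) * phi V n x

/-- `ψ = √b_{n-1} φ_{n-1}`, as an element of `L²(Jᶜ)` (for `n ≥ 1`). -/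
def bigPsi (V : ℝ → EReal) (J : Set ℝ) (n : ℕ) : L2c J :=
  toL2c J fun x => √(recB V (n - 1)) * phi V (n - 1) x

/-- The resolvent `(I - K_n^J)⁻¹` (the inverse in the ring of bounded operators). -/
def resolvent (V : ℝ → EReal) (J : Set ℝ) (n : ℕ) : L2c J →L[ℝ] L2c J :=
  Ring.inverse (1 - opK V J n)

/-- The inner product `v_n = (φ, (I - K_n^J)⁻¹ ψ)` in `L²(Jᶜ)`. -/
def innerV (V : ℝ → EReal) (J : Set ℝ) (n : ℕ) : ℝ :=
  ⟪bigPhi V J n, resolvent V J n (bigPsi V J n)⟫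

/-- The matrix integral `τ_n^J = (1/n!) ∫_{J^n} ∏_{i<j} (x_j - x_i)² ∏_i e^{-V(x_i)} dx_i`. -/
def tau (V : ℝ → EReal) (J : Set ℝ) (n : ℕ) : ℝ :=
  ((n ! : ℕ) : ℝ)⁻¹ * ∫ x : Fin n → ℝ in Set.univ.pi fun _ => J,
    (∏ i : Fin n, ∏ j ∈ Finset.Ioi i, (x j - x i)) ^ 2 * ∏ i : Fin n, weight V (x i)

end UnitaryEnsemble

end

/-! Fix `t` and use the orthonormal polynomials `π_k` of its weight as a basis, even when `t_1`
moves by `s`. Moving `t_1` multiplies the weight by `e^{sx}`. By Vandermonde and Andréief, both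
matrix integrals are the same constant times the determinants of the `n × n` Gram matrices `A(s)`
over `J` and `B(s)` over `ℝ`, so the constant cancels in the ratio (`tau_eq_det_gramMatrix`).

At `s = 0`, `B = 1`, and by Jacobi's formula the logarithmic derivative is `tr(A⁻¹A') - tr B'`.
Differentiating in `s` inserts a factor `x`, and the recurrence gives `A' = Q A + b_{n-1} e_{n-1}
uᵀ`, with `Q` the truncated Jacobi matrix and `u_k = ∫_J π_n π_k ρ_t` (`gramMatrix_X_mul`). Over `ℝ`
the remainder vanishes by orthogonality, so `B' = Q`. Both traces contain `tr Q`; what survives is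
`b_{n-1} ∑_k (A⁻¹)_{k,n-1} u_k`.

On the operator side, the Gram matrix of `φ_0, …, φ_{n-1}` on `Jᶜ` is `1 - A`. Hence `I - K_n^J`
acts on their span through `A`, and its inverse sends `φ_{n-1}` to `∑_k (A⁻¹)_{k,n-1} φ_k`
(`inverse_one_sub_gramOp_apply`). Since `(φ_n, φ_k) = -u_k` on `Jᶜ` for `k < n`, `v_n` is minus the
surviving term (`innerV_eq`). -/

namespace UnitaryEnsemble

/-! ### Determinants: Andréief's identity and Jacobi's formula. -/

/-- Andréief's identity for a weighted product measure. -/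
theorem integral_det_sq_mul_prod {n : ℕ} (μ : Measure ℝ) [SigmaFinite μ] (f : Fin n → ℝ → ℝ)
    (w : ℝ → ℝ) (hf : ∀ i j, Integrable (fun x => f i x * f j x * w x) μ) :
    ∫ x : Fin n → ℝ, (Matrix.of fun i j => f j (x i)).det ^ 2 * ∏ i, w (x i)
        ∂(Measure.pi fun _ => μ) =
      (n ! : ℝ) * (Matrix.of fun i j => ∫ x, f i x * f j x * w x ∂μ).det := by
  have hexp : ∀ x : Fin n → ℝ, (Matrix.of fun i j => f j (x i)).det ^ 2 * ∏ i, w (x i) =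
      ∑ σ : Equiv.Perm (Fin n), ∑ π : Equiv.Perm (Fin n),
        ((Equiv.Perm.sign σ : ℤ) : ℝ) * ((Equiv.Perm.sign π : ℤ) : ℝ) *
          ∏ i, (f (σ i) (x i) * f (π i) (x i) * w (x i)) := by
    intro x
    rw [← Matrix.det_transpose, Matrix.det_apply', sq, Finset.sum_mul_sum, Finset.sum_mul]
    refine Finset.sum_congr rfl fun σ _ => ?_
    rw [Finset.sum_mul]
    refine Finset.sum_congr rfl fun π _ => ?_
    simp only [Matrix.transpose_apply, Matrix.of_apply, Finset.prod_mul_distrib]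
    ring
  have hint : ∀ σ π : Equiv.Perm (Fin n), Integrable (fun x : Fin n → ℝ =>
      ((Equiv.Perm.sign σ : ℤ) : ℝ) * ((Equiv.Perm.sign π : ℤ) : ℝ) *
          ∏ i, (f (σ i) (x i) * f (π i) (x i) * w (x i))) (Measure.pi fun _ => μ) :=
    fun σ π => (Integrable.fintype_prod (μ := fun _ => μ)
      (f := fun i y => f (σ i) y * f (π i) y * w y) fun i => hf (σ i) (π i)).const_mul _
  simp_rw [hexp]
  rw [integral_finsetSum _ fun σ _ => integrable_finsetSum _ fun π _ => hint σ π]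
  simp_rw [integral_finsetSum _ fun π _ => hint _ π, integral_const_mul]
  set M : Matrix (Fin n) (Fin n) ℝ := Matrix.of fun i j => ∫ x, f i x * f j x * w x ∂μ with hM
  -- For fixed `σ`, the sum over `π` is the determinant of `M` with rows permuted by `σ`. The two
  -- signs of `σ` cancel, so all `n!` values of `σ` contribute `det M`.
  have hσ : ∀ σ : Equiv.Perm (Fin n), ∑ π : Equiv.Perm (Fin n),
      ((Equiv.Perm.sign σ : ℤ) : ℝ) * ((Equiv.Perm.sign π : ℤ) : ℝ) *
        ∫ x : Fin n → ℝ, ∏ i, (f (σ i) (x i) * f (π i) (x i) * w (x i))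
          ∂(Measure.pi fun _ => μ) = M.det := by
    intro σ
    have h1 : ∀ π : Equiv.Perm (Fin n),
        ∫ x : Fin n → ℝ, ∏ i, (f (σ i) (x i) * f (π i) (x i) * w (x i))
          ∂(Measure.pi fun _ => μ) = ∏ i, M (σ i) (π i) := fun π =>
      integral_fintype_prod_eq_prod (μ := fun _ => μ)
        fun i y => f (σ i) y * f (π i) y * w y
    have h2 := Matrix.det_permute σ M
    rw [← Matrix.det_transpose, Matrix.det_apply'] at h2
    have h3 : ((Equiv.Perm.sign σ : ℤ) : ℝ) * ((Equiv.Perm.sign σ : ℤ) : ℝ) = 1 := by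
      rw [← Int.cast_mul, ← Units.val_mul, Int.units_mul_self]; simp
    calc _ = ((Equiv.Perm.sign σ : ℤ) : ℝ) * ∑ π : Equiv.Perm (Fin n),
          ((Equiv.Perm.sign π : ℤ) : ℝ) * ∏ i, M (σ i) (π i) := by
          rw [Finset.mul_sum]
          exact Finset.sum_congr rfl fun π _ => by rw [h1, mul_assoc]
      _ = M.det := by
          simp only [Matrix.transpose_apply, Matrix.submatrix_apply, id] at h2
          rw [h2, ← mul_assoc, h3, one_mul]
  simp_rw [hσ]
  simp [Fintype.card_perm]

/-- The derivative of a determinant at the identity matrix is the trace. -/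
theorem hasDerivAt_det_of_eq_one {n : Type*} [Fintype n] [DecidableEq n] {M : ℝ → Matrix n n ℝ}
    {M' : Matrix n n ℝ} {s : ℝ} (h1 : M s = 1)
    (hM : ∀ i j, HasDerivAt (fun r => M r i j) (M' i j) s) :
    HasDerivAt (fun r => (M r).det) M'.trace s := by
  have h : HasDerivAt (fun r => ∑ σ : Equiv.Perm n,
      ((Equiv.Perm.sign σ : ℤ) : ℝ) * ∏ i, M r (σ i) i)
      (∑ σ : Equiv.Perm n, ((Equiv.Perm.sign σ : ℤ) : ℝ) *
        ∑ i, (∏ j ∈ Finset.univ.erase i, M s (σ j) j) • M' (σ i) i) s :=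
    HasDerivAt.fun_sum fun σ _ =>
      (HasDerivAt.fun_finsetProd fun i _ => hM (σ i) i).const_mul _
  simp_rw [Matrix.det_apply']
  convert h using 1
  rw [Finset.sum_eq_single 1]
  · simp [h1, Matrix.trace, Finset.prod_eq_one]
  · intro σ _ hσ
    rw [Finset.sum_eq_zero, mul_zero]
    intro i _
    -- A nontrivial permutation moves at least two points, so after the factor at `i` is
    -- differentiated an off-diagonal zero of the identity matrix remains.
    obtain ⟨j, hji, hj⟩ : ∃ j, j ≠ i ∧ σ j ≠ j := by
      by_contra! hcon
      refine hσ (Equiv.ext fun k => ?_)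
      by_cases hk : k = i
      · subst hk
        by_contra hne
        exact hne (σ.injective (hcon (σ k) hne))
      · exact hcon k hk
    rw [Finset.prod_eq_zero (Finset.mem_erase.2 ⟨hji, Finset.mem_univ j⟩), zero_smul]
    rw [h1, Matrix.one_apply_ne hj]
  · simp

/-- Jacobi's formula for the logarithmic derivative of a determinant. -/
theorem hasDerivAt_det {n : Type*} [Fintype n] [DecidableEq n] {M : ℝ → Matrix n n ℝ}
    {M' : Matrix n n ℝ} {s : ℝ} (h0 : (M s).det ≠ 0)
    (hM : ∀ i j, HasDerivAt (fun r => M r i j) (M' i j) s) :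
    HasDerivAt (fun r => (M r).det) ((M s).det * ((M s)⁻¹ * M').trace) s := by
  have hu : IsUnit (M s).det := isUnit_iff_ne_zero.2 h0
  -- Left multiplication by `(M s)⁻¹` reduces to the case where the matrix is the identity at `s`.
  have h := (hasDerivAt_det_of_eq_one (M := fun r => (M s)⁻¹ * M r) (M' := (M s)⁻¹ * M') (s := s)
    (Matrix.nonsing_inv_mul _ hu) fun i j => by
      simp only [Matrix.mul_apply]
      exact HasDerivAt.fun_sum fun k _ => (hM k j).const_mul _).const_mul (M s).det
  refine h.congr_of_eventuallyEq (Eventually.of_forall fun r => ?_)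
  simp [Matrix.det_nonsing_inv, mul_inv_cancel_left₀ h0]

/-! ### Resolvents of finite rank operators through Gram matrices. -/

section FiniteRank

variable {H : Type*} [NormedAddCommGroup H] [InnerProductSpace ℝ H] {n : ℕ}

/-- The finite rank operator `∑ e_k ⊗ e_k`. -/
noncomputable def gramOp (e : Fin n → H) : H →L[ℝ] H :=
  ∑ k, (innerSL ℝ (e k)).smulRight (e k)

theorem gramOp_apply (e : Fin n → H) (f : H) : gramOp e f = ∑ k, ⟪e k, f⟫ • e k := by
  simp [gramOp]

theorem inner_gramOp_left (e : Fin n → H) (f g : H) : ⟪gramOp e f, g⟫ = ⟪f, gramOp e g⟫ := by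
  simp only [gramOp_apply, sum_inner, inner_sum, inner_smul_left, inner_smul_right]
  refine Finset.sum_congr rfl fun k _ => ?_
  rw [real_inner_comm f (e k)]
  simp [mul_comm]

/-- If `A = 1 - G` with the Gram matrix `G` of `e`, then `(1 - ∑ e_k ⊗ e_k) e_j = ∑ A_kj e_k`. -/
theorem one_sub_gramOp_apply {e : Fin n → H} {A : Matrix (Fin n) (Fin n) ℝ}
    (hA : ∀ i j, A i j = (1 : Matrix (Fin n) (Fin n) ℝ) i j - ⟪e i, e j⟫) (j : Fin n) :
    (1 - gramOp e) (e j) = ∑ k, A k j • e k := by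
  simp [gramOp_apply, hA, sub_smul, Matrix.one_apply, Finset.sum_sub_distrib]

theorem inner_one_sub_gramOp {e : Fin n → H} {A : Matrix (Fin n) (Fin n) ℝ}
    (hA : ∀ i j, A i j = (1 : Matrix (Fin n) (Fin n) ℝ) i j - ⟪e i, e j⟫) (k : Fin n) (f : H) :
    ⟪e k, (1 - gramOp e) f⟫ = ∑ i, A k i * ⟪e i, f⟫ := by
  simp only [hA, sub_mul, Finset.sum_sub_distrib]
  simp [gramOp_apply, Matrix.one_apply, inner_sub_right, inner_sum, inner_smul_right, mul_comm]

/-- The inverse is explicit, so neither completeness of `H` nor linear independence of `e` is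
needed. -/
theorem isUnit_one_sub_gramOp {e : Fin n → H} {A : Matrix (Fin n) (Fin n) ℝ}
    (hA : ∀ i j, A i j = (1 : Matrix (Fin n) (Fin n) ℝ) i j - ⟪e i, e j⟫) (h0 : A.det ≠ 0) :
    IsUnit (1 - gramOp e) := by
  have hu : IsUnit A.det := isUnit_iff_ne_zero.2 h0
  have hl : ∀ i k, ∑ j, A i j * A⁻¹ j k = (1 : Matrix (Fin n) (Fin n) ℝ) i k := fun i k => by
    rw [← Matrix.mul_apply, Matrix.mul_nonsing_inv _ hu]
  have hr : ∀ i k, ∑ j, A⁻¹ i j * A j k = (1 : Matrix (Fin n) (Fin n) ℝ) i k := fun i k => by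
    rw [← Matrix.mul_apply, Matrix.nonsing_inv_mul _ hu]
  -- With `E c = ∑ c_k e_k`, the operator is `1 - E Eᵀ` and `A = 1 - Eᵀ E`; the witness is `1 + E
  -- A⁻¹ Eᵀ`.
  let R : H →L[ℝ] H := 1 + ∑ j, ∑ k, A⁻¹ j k • (innerSL ℝ (e k)).smulRight (e j)
  have hR : ∀ f, R f = f + ∑ j, ∑ k, (A⁻¹ j k * ⟪e k, f⟫) • e j := fun f => by
    simp [R, smul_smul]
  refine ⟨⟨1 - gramOp e, R, ?_, ?_⟩, rfl⟩
  · ext f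
    change (1 - gramOp e) (R f) = f
    rw [hR, map_add, map_sum]
    simp_rw [map_sum, map_smul, one_sub_gramOp_apply hA]
    have : ∑ j, ∑ k, (A⁻¹ j k * ⟪e k, f⟫) • ∑ i, A i j • e i = gramOp e f := by
      calc _ = ∑ i, ∑ k, ((∑ j, A i j * A⁻¹ j k) * ⟪e k, f⟫) • e i := by
            simp_rw [Finset.smul_sum, smul_smul, Finset.sum_mul, Finset.sum_smul]
            rw [Finset.sum_comm' (t' := Finset.univ) (s' := fun _ => Finset.univ) (by simp)]
            rw [Finset.sum_congr rfl fun k _ => Finset.sum_comm]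
            rw [Finset.sum_comm]
            refine Finset.sum_congr rfl fun i _ => Finset.sum_congr rfl fun k _ =>
              Finset.sum_congr rfl fun j _ => by ring_nf
        _ = _ := by simp [hl, Matrix.one_apply, gramOp_apply]
    rw [this]
    simp
  · ext f
    change R ((1 - gramOp e) f) = f
    rw [hR]
    simp_rw [inner_one_sub_gramOp hA]
    have : ∑ j, ∑ k, (A⁻¹ j k * ∑ i, A k i * ⟪e i, f⟫) • e j = gramOp e f := by
      calc _ = ∑ j, ∑ i, ((∑ k, A⁻¹ j k * A k i) * ⟪e i, f⟫) • e j := by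
            refine Finset.sum_congr rfl fun j _ => ?_
            simp_rw [Finset.mul_sum, Finset.sum_mul, Finset.sum_smul, ← mul_assoc]
            exact Finset.sum_comm
        _ = _ := by simp [hr, Matrix.one_apply, gramOp_apply]
    rw [this]
    simp

theorem inverse_one_sub_gramOp_apply {e : Fin n → H} {A : Matrix (Fin n) (Fin n) ℝ}
    (hA : ∀ i j, A i j = (1 : Matrix (Fin n) (Fin n) ℝ) i j - ⟪e i, e j⟫) (h0 : A.det ≠ 0)
    (j : Fin n) :
    Ring.inverse (1 - gramOp e) (e j) = ∑ k, A⁻¹ k j • e k := by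
  have hu : IsUnit A.det := isUnit_iff_ne_zero.2 h0
  have h1 : (1 - gramOp e) (∑ k, A⁻¹ k j • e k) = e j := by
    simp_rw [map_sum, map_smul, one_sub_gramOp_apply hA, Finset.smul_sum, smul_smul]
    rw [Finset.sum_comm]
    have : ∀ i, ∑ k, A⁻¹ k j * A i k = (1 : Matrix (Fin n) (Fin n) ℝ) i j := fun i => by
      rw [← Matrix.mul_nonsing_inv _ hu, Matrix.mul_apply]
      exact Finset.sum_congr rfl fun k _ => mul_comm _ _
    simp_rw [← Finset.sum_smul, this]
    simp [Matrix.one_apply]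
  rw [← h1]
  exact DFunLike.congr_fun (Ring.inverse_mul_cancel _ (isUnit_one_sub_gramOp hA h0)) _

/-- The inverse of a symmetric operator is symmetric. -/
theorem inner_inverse_one_sub_gramOp_comm {e : Fin n → H} (h : IsUnit (1 - gramOp e)) (f g : H) :
    ⟪f, Ring.inverse (1 - gramOp e) g⟫ = ⟪g, Ring.inverse (1 - gramOp e) f⟫ := by
  have hinv : ∀ f, (1 - gramOp e) (Ring.inverse (1 - gramOp e) f) = f := fun f =>
    DFunLike.congr_fun (Ring.mul_inverse_cancel _ h) f
  have hsymm : ∀ f g : H, ⟪(1 - gramOp e) f, g⟫ = ⟪f, (1 - gramOp e) g⟫ := fun f g => by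
    simp [inner_sub_left, inner_sub_right, inner_gramOp_left]
  conv_lhs => rw [← hinv f, hsymm, hinv g, real_inner_comm]

end FiniteRank

/-! ### Moments of exponentially tilted weights. -/

section ExponentialMoments

variable {ν : Measure ℝ} {w : ℝ → ℝ}

theorem withDensity_interior_integrableExpSet (hw : ∀ x, 0 ≤ w x)
    (hexp : ∀ᶠ s in 𝓝 (0 : ℝ), Integrable (fun x => w x * Real.exp (s * x)) ν) :
    (0 : ℝ) ∈ interior (ProbabilityTheory.integrableExpSet id
      (ν.withDensity fun x => ENNReal.ofReal (w x))) := by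
  have hwm : AEMeasurable w ν := by simpa using hexp.self_of_nhds.aemeasurable
  rw [mem_interior_iff_mem_nhds]
  filter_upwards [hexp] with s hs
  change Integrable _ _
  rw [integrable_withDensity_iff_integrable_smul₀' hwm.ennreal_ofReal (by simp)]
  simpa [ENNReal.toReal_ofReal (hw _)] using hs

/-- In the interior of the set where the exponential moment is finite, all polynomial moments are
finite; that interior is one neighbourhood serving every `p`. -/
theorem eventually_integrable_eval_mul_exp (hw : ∀ x, 0 ≤ w x)
    (hexp : ∀ᶠ s in 𝓝 (0 : ℝ), Integrable (fun x => w x * Real.exp (s * x)) ν) :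
    ∀ᶠ s in 𝓝 (0 : ℝ), ∀ p : ℝ[X],
      Integrable (fun x => p.eval x * (w x * Real.exp (s * x))) ν := by
  have hwm : AEMeasurable w ν := by simpa using hexp.self_of_nhds.aemeasurable
  filter_upwards [isOpen_interior.eventually_mem (withDensity_interior_integrableExpSet hw hexp)]
    with s hs p
  induction p using Polynomial.induction_on' with
  | add p q hp hq =>
    simp only [eval_add, add_mul]
    exact hp.add hq
  | monomial k a =>
    have h := ProbabilityTheory.integrable_pow_mul_exp_of_mem_interior_integrableExpSet hs k
    rw [integrable_withDensity_iff_integrable_smul₀' hwm.ennreal_ofReal (by simp)] at h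
    refine (h.const_mul a).congr (Eventually.of_forall fun x => ?_)
    simp only [ENNReal.toReal_ofReal (hw _), id, smul_eq_mul, eval_monomial]
    ring

theorem hasDerivAt_integral_eval_mul_exp (hw : ∀ x, 0 ≤ w x)
    (hexp : ∀ᶠ s in 𝓝 (0 : ℝ), Integrable (fun x => w x * Real.exp (s * x)) ν) (p : ℝ[X]) :
    HasDerivAt (fun s => ∫ x, p.eval x * (w x * Real.exp (s * x)) ∂ν)
      (∫ x, (X * p).eval x * w x ∂ν) 0 := by
  have hwm : AEMeasurable w ν := by simpa using hexp.self_of_nhds.aemeasurable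
  have hint := eventually_integrable_eval_mul_exp hw hexp
  induction p using Polynomial.induction_on' with
  | add p q hp hq =>
    have h0 : ∀ p : ℝ[X], Integrable (fun x => p.eval x * w x) ν := by
      simpa using hint.self_of_nhds
    have h := hp.add hq
    rw [← integral_add (h0 _) (h0 _)] at h
    simp_rw [← add_mul, ← eval_add, ← mul_add] at h
    refine h.congr_of_eventuallyEq ?_
    -- Splitting the integral requires both summands to be integrable, which is known only for `s`
    -- near `0`.
    filter_upwards [hint] with s hs
    simp only [Pi.add_apply, eval_add, add_mul]
    exact integral_add (hs p) (hs q)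
  | monomial k a =>
    have h := (ProbabilityTheory.hasDerivAt_integral_pow_mul_exp_real
      (withDensity_interior_integrableExpSet hw hexp) k).const_mul a
    simp_rw [integral_withDensity_eq_integral_toReal_smul₀ hwm.ennreal_ofReal
      (Eventually.of_forall fun _ => ENNReal.ofReal_lt_top), ENNReal.toReal_ofReal (hw _), id,
      smul_eq_mul, ← integral_const_mul] at h
    have h1 : ∀ s : ℝ, ∫ x, (monomial k a).eval x * (w x * Real.exp (s * x)) ∂ν =
        ∫ x, a * (w x * (x ^ k * Real.exp (s * x))) ∂ν := fun s => by
      congr 1 with x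
      rw [eval_monomial]
      ring
    have h2 : ∫ x, (X * monomial k a).eval x * w x ∂ν =
        ∫ x, a * (w x * (x ^ (k + 1) * Real.exp (0 * x))) ∂ν := by
      congr 1 with x
      rw [eval_mul, eval_X, eval_monomial, zero_mul, Real.exp_zero]
      ring
    simp_rw [h1, h2]
    exact h

/-- A nonzero polynomial has finitely many roots, a null set, so it cannot vanish almost everywhere
on `S ∩ {w > 0}`. -/
theorem setIntegral_sq_eval_pos (hw : ∀ x, 0 ≤ w x) {S : Set ℝ}
    (hpos : volume (S ∩ {x | 0 < w x}) ≠ 0) {p : ℝ[X]} (hp : p ≠ 0)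
    (hint : Integrable (fun x => (p * p).eval x * w x)) :
    0 < ∫ x in S, (p * p).eval x * w x := by
  rw [setIntegral_pos_iff_support_of_nonneg_ae
    (Eventually.of_forall fun x => by
      simpa using mul_nonneg (mul_self_nonneg (p.eval x)) (hw x)) hint.integrableOn]
  refine pos_iff_ne_zero.2 fun h0 => hpos ?_
  refine measure_mono_null (t := (Function.support (fun x => (p * p).eval x * w x) ∩ S) ∪
    (p.roots.toFinset : Set ℝ)) ?_
    (measure_union_null h0 (p.roots.toFinset.finite_toSet.measure_zero volume))
  rintro x ⟨hxS, hx⟩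
  by_cases hr : p.eval x = 0
  · right
    simpa [hp] using hr
  · left
    refine ⟨?_, hxS⟩
    have : 0 < w x := hx
    simp [hr, this.ne']

end ExponentialMoments

/-! ### The weight under the Toda deformation. -/

theorem weight_nonneg (V : ℝ → EReal) (x : ℝ) : 0 ≤ weight V x := ENNReal.toReal_nonneg

theorem weight_pos {V : ℝ → EReal} {x : ℝ} (hb : V x ≠ ⊥) (ht : V x ≠ ⊤) : 0 < weight V x := by
  unfold weight
  lift V x to ℝ using ⟨ht, hb⟩ with v
  rw [← EReal.coe_neg, EReal.exp_coe, ENNReal.toReal_ofReal (Real.exp_pos _).le]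
  exact Real.exp_pos _

theorem weight_eq_zero {V : ℝ → EReal} {x : ℝ} (ht : V x = ⊤) : weight V x = 0 := by
  simp [weight, ht]

theorem weight_toda_pos {V : ℝ → EReal} (t : ℕ+ → ℝ) {x : ℝ} (hb : V x ≠ ⊥) (ht : V x ≠ ⊤) :
    0 < weight (toda V t) x := by
  rw [weight_toda t hb]
  exact mul_pos (weight_pos hb ht) (Real.exp_pos _)

/-- Changing the first time multiplies the weight by an exponential. -/
theorem weight_toda_update {V : ℝ → EReal} (t : ℕ+ → ℝ) (s : ℝ) {x : ℝ} (hb : V x ≠ ⊥)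
    (hx : V x ≠ ⊤ → Summable fun k : ℕ+ => t k * x ^ (k : ℕ)) :
    weight (toda V (Function.update t 1 s)) x =
      weight (toda V t) x * Real.exp ((s - t 1) * x) := by
  rw [weight_toda _ hb, weight_toda _ hb]
  by_cases ht : V x = ⊤
  · simp [weight_eq_zero ht]
  · have hs : (fun k : ℕ+ => Function.update t 1 s k * x ^ (k : ℕ)) =
        Function.update (fun k : ℕ+ => t k * x ^ (k : ℕ)) 1 (s * x) := by
      funext k
      by_cases hk : k = 1
      · subst hk; simp
      · simp [hk]
    -- Summability is essential: a divergent `tsum` defaults to `0` and would not see the changed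
    -- term.
    have h := ((hx ht).hasSum.update 1 (s * x)).tsum_eq
    rw [hs, h, mul_assoc, ← Real.exp_add]
    congr 2
    simp
    ring

/-! ### Orthonormal polynomials and the truncated recurrence. -/

section OrthogonalPolynomials

variable {W : ℝ → EReal}

theorem polyInner_comm (p q : ℝ[X]) : polyInner W p q = polyInner W q p := by
  simp only [polyInner, mul_comm (p.eval _)]

theorem polyInner_eq_integral (p q : ℝ[X]) :
    polyInner W p q = ∫ x, (p * q).eval x * weight W x := by
  simp [polyInner]

theorem polyInner_C_mul_left (a : ℝ) (p q : ℝ[X]) :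
    polyInner W (C a * p) q = a * polyInner W p q := by
  simp [polyInner, mul_assoc, integral_const_mul]

theorem polyInner_C_mul_right (a : ℝ) (p q : ℝ[X]) :
    polyInner W p (C a * q) = a * polyInner W p q := by
  rw [polyInner_comm, polyInner_C_mul_left, polyInner_comm]

theorem polyInner_sub_left (hint : ∀ p : ℝ[X], Integrable fun x => p.eval x * weight W x)
    (p q r : ℝ[X]) : polyInner W (p - q) r = polyInner W p r - polyInner W q r := by
  simp only [polyInner_eq_integral]
  rw [← integral_sub (hint _) (hint _)]
  congr 1 with x
  simp only [eval_mul, eval_sub]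
  ring

theorem polyInner_sum_left (hint : ∀ p : ℝ[X], Integrable fun x => p.eval x * weight W x)
    {ι : Type*} (s : Finset ι) (p : ι → ℝ[X]) (r : ℝ[X]) :
    polyInner W (∑ i ∈ s, p i) r = ∑ i ∈ s, polyInner W (p i) r := by
  simp only [polyInner_eq_integral]
  rw [← integral_finsetSum _ fun i _ => hint _]
  simp [Finset.sum_mul, eval_finsetSum]

theorem monicOP_monic_natDegree (W : ℝ → EReal) (n : ℕ) :
    (monicOP W n).Monic ∧ (monicOP W n).natDegree = n := by
  induction n using Nat.strong_induction_on with
  | _ n ih =>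
    have hlt : (∑ k : Fin n, C (polyInner W (X ^ n) (monicOP W k) /
        polyInner W (monicOP W k) (monicOP W k)) * monicOP W k).degree < n := by
      rw [← mem_degreeLT]
      refine Submodule.sum_mem _ fun k _ => ?_
      rw [← smul_eq_C_mul]
      refine Submodule.smul_mem _ _ (mem_degreeLT.2 ?_)
      rw [degree_eq_natDegree (ih k k.isLt).1.ne_zero, (ih k k.isLt).2]
      exact_mod_cast k.isLt
    rw [monicOP]
    exact ⟨monic_X_pow_sub hlt, natDegree_eq_of_degree_eq_some (by
      rw [degree_sub_eq_left_of_degree_lt (by simpa using hlt), degree_X_pow])⟩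

theorem monicOP_monic (W : ℝ → EReal) (n : ℕ) : (monicOP W n).Monic :=
  (monicOP_monic_natDegree W n).1

theorem monicOP_natDegree (W : ℝ → EReal) (n : ℕ) : (monicOP W n).natDegree = n :=
  (monicOP_monic_natDegree W n).2

theorem monicOP_degree (W : ℝ → EReal) (n : ℕ) : (monicOP W n).degree = n := by
  rw [degree_eq_natDegree (monicOP_monic W n).ne_zero, monicOP_natDegree]

variable (hint : ∀ p : ℝ[X], Integrable fun x => p.eval x * weight W x)
  (hpos : ∀ p : ℝ[X], p ≠ 0 → 0 < polyInner W p p)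

include hint hpos

theorem polyInner_monicOP_of_lt {k n : ℕ} (hk : k < n) :
    polyInner W (monicOP W n) (monicOP W k) = 0 := by
  induction n using Nat.strong_induction_on generalizing k with
  | _ n ih =>
    rw [monicOP, polyInner_sub_left hint, polyInner_sum_left hint,
      Finset.sum_eq_single (⟨k, hk⟩ : Fin n)]
    · rw [polyInner_C_mul_left, div_mul_cancel₀ _ (hpos _ (monicOP_monic W k).ne_zero).ne',
        sub_self]
    · intro j _ hj
      rw [polyInner_C_mul_left]
      rcases lt_trichotomy (j : ℕ) k with h | h | h
      · rw [polyInner_comm (monicOP W j) (monicOP W k), ih k hk h, mul_zero]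
      · exact absurd (Fin.ext h) hj
      · rw [ih j j.isLt h, mul_zero]
    · simp

theorem polyInner_orthoPoly (i j : ℕ) :
    polyInner W (orthoPoly W i) (orthoPoly W j) = if i = j then 1 else 0 := by
  rw [orthoPoly, orthoPoly, polyInner_C_mul_left, polyInner_C_mul_right]
  split_ifs with h
  · subst h
    have h0 := hpos _ (monicOP_monic W i).ne_zero
    rw [← mul_assoc, ← mul_inv, Real.mul_self_sqrt h0.le, inv_mul_cancel₀ h0.ne']
  · rcases lt_or_gt_of_ne h with h | h
    · rw [polyInner_comm (monicOP W i) (monicOP W j), polyInner_monicOP_of_lt hint hpos h]; simp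
    · rw [polyInner_monicOP_of_lt hint hpos h]; simp

omit hint in
theorem orthoPoly_coeff_pos (n : ℕ) : 0 < (√(polyInner W (monicOP W n) (monicOP W n)))⁻¹ :=
  inv_pos.2 (Real.sqrt_pos.2 (hpos _ (monicOP_monic W n).ne_zero))

omit hint in
theorem orthoPoly_degree (n : ℕ) : (orthoPoly W n).degree = n := by
  rw [orthoPoly, degree_C_mul (orthoPoly_coeff_pos hpos n).ne', monicOP_degree]

omit hint in
theorem exists_eq_sum_orthoPoly {m : ℕ} {p : ℝ[X]} (hp : p.degree < m) :
    ∃ c : ℕ → ℝ, p = ∑ k ∈ Finset.range m, C (c k) * orthoPoly W k := by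
  induction m generalizing p with
  | zero =>
    refine ⟨0, ?_⟩
    simpa [Polynomial.degree_eq_bot] using hp
  | succ m ih =>
    have ha := (orthoPoly_coeff_pos hpos m).ne'
    set a := (√(polyInner W (monicOP W m) (monicOP W m)))⁻¹ with hadef
    have hq : (p - C (p.coeff m) * monicOP W m).degree < m := by
      rw [degree_lt_iff_coeff_zero] at hp ⊢
      intro k hk
      rw [coeff_sub, coeff_C_mul]
      rcases hk.eq_or_lt with rfl | hk
      · have h1 : (monicOP W m).coeff m = 1 := by
          simpa [Monic, leadingCoeff, monicOP_natDegree] using monicOP_monic W m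
        simp [h1]
      · rw [hp k hk, coeff_eq_zero_of_natDegree_lt (p := monicOP W m) (by rwa [monicOP_natDegree])]
        simp
    obtain ⟨c, hc⟩ := ih hq
    -- Here `orthoPoly W m = C a * monicOP W m`, so the leading coefficient is divided by `a`.
    refine ⟨Function.update c m (p.coeff m * a⁻¹), ?_⟩
    rw [Finset.sum_range_succ, Finset.sum_congr rfl fun k hk => by
      rw [Function.update_of_ne (Finset.mem_range.1 hk).ne], ← hc, Function.update_self,
      orthoPoly, ← hadef, ← mul_assoc, ← C_mul, mul_assoc, inv_mul_cancel₀ ha, mul_one]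
    ring

/-- Expansion of a polynomial in the orthonormal polynomials. -/
theorem eq_sum_polyInner_orthoPoly {m : ℕ} {p : ℝ[X]} (hp : p.degree < m) :
    p = ∑ k ∈ Finset.range m, C (polyInner W p (orthoPoly W k)) * orthoPoly W k := by
  obtain ⟨c, hc⟩ := exists_eq_sum_orthoPoly (W := W) hpos hp
  conv_lhs => rw [hc]
  refine Finset.sum_congr rfl fun k hk => ?_
  congr 2
  conv_rhs => rw [hc]
  simp [polyInner_sum_left hint, polyInner_C_mul_left, polyInner_orthoPoly hint hpos,
    Finset.mem_range.1 hk]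

theorem polyInner_orthoPoly_of_degree_lt {m : ℕ} {p : ℝ[X]} (hp : p.degree < m) :
    polyInner W p (orthoPoly W m) = 0 := by
  rw [eq_sum_polyInner_orthoPoly hint hpos hp, polyInner_sum_left hint]
  refine Finset.sum_eq_zero fun k hk => ?_
  rw [polyInner_C_mul_left, polyInner_orthoPoly hint hpos, if_neg (Finset.mem_range.1 hk).ne,
    mul_zero]

omit hint hpos in
theorem sqrt_weight_mul_self (x : ℝ) : √(weight W x) * √(weight W x) = weight W x :=
  Real.mul_self_sqrt (weight_nonneg W x)

omit hint hpos in
theorem recB_eq (k : ℕ) :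
    recB W k = polyInner W (X * orthoPoly W k) (orthoPoly W (k + 1)) := by
  rw [recB, polyInner]
  congr 1 with x
  rw [phi, phi, eval_mul, eval_X]
  linear_combination x * (orthoPoly W k).eval x * (orthoPoly W (k + 1)).eval x *
    sqrt_weight_mul_self (W := W) x

/-- With `p_k` monic orthogonal, `x p_k - p_{k+1}` has degree at most `k`, so `b_k = ‖p_{k+1}‖ /
‖p_k‖`. Nonnegativity is what makes `√b_k · √b_k = b_k` in `v_n`. -/
theorem recB_nonneg (k : ℕ) : 0 ≤ recB W k := by
  have hd : (X * monicOP W k - monicOP W (k + 1)).degree < ((k + 1 : ℕ) : WithBot ℕ) := by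
    have h1 : (X * monicOP W k).degree = ((k + 1 : ℕ) : WithBot ℕ) := by
      rw [degree_mul, degree_X, monicOP_degree, add_comm]; rfl
    rw [← h1]
    refine degree_sub_lt_left (by rw [h1, monicOP_degree]) ?_ ?_
    · exact mul_ne_zero X_ne_zero (monicOP_monic W k).ne_zero
    · rw [(monicOP_monic W (k + 1)).leadingCoeff, (monic_X.mul (monicOP_monic W k)).leadingCoeff]
  have h := polyInner_orthoPoly_of_degree_lt hint hpos hd
  rw [polyInner_sub_left hint, sub_eq_zero] at h
  rw [recB_eq]
  conv in orthoPoly W k => rw [orthoPoly]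
  rw [← mul_assoc, mul_comm X, mul_assoc, polyInner_C_mul_left, h, orthoPoly,
    polyInner_C_mul_right]
  have := (hpos _ (monicOP_monic W (k + 1)).ne_zero).le
  positivity

/-- The truncated three-term recurrence: only the last row of the truncated Jacobi matrix has a
remainder. -/
theorem X_mul_orthoPoly {n i : ℕ} (hi : i < n) :
    X * orthoPoly W i = (∑ k ∈ Finset.range n,
      C (polyInner W (X * orthoPoly W i) (orthoPoly W k)) * orthoPoly W k) +
      C (if i + 1 = n then recB W i else 0) * orthoPoly W n := by
  have hd : (X * orthoPoly W i).degree = ((i + 1 : ℕ) : WithBot ℕ) := by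
    rw [degree_mul, degree_X, orthoPoly_degree hpos, add_comm]; rfl
  have h := eq_sum_polyInner_orthoPoly hint hpos (p := X * orthoPoly W i) (m := n + 1) (by
    rw [hd]; exact_mod_cast Nat.add_lt_add_right hi 1)
  rw [Finset.sum_range_succ] at h
  conv_lhs => rw [h]
  congr 3
  split_ifs with hin
  · subst hin
    rw [recB_eq]
  · exact polyInner_orthoPoly_of_degree_lt hint hpos (by
      rw [hd]; exact_mod_cast lt_of_le_of_ne hi hin)

end OrthogonalPolynomials

/-! ### Gram matrices over a set, matrix integrals and the operator `K_n^J`. -/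

section GramMatrices

variable {W : ℝ → EReal}

/-- The Gram matrix over `S` of the first `n` orthonormal polynomials of the weight `e^{-W}`, with
respect to another weight `u`. -/
noncomputable def gramMatrix (W : ℝ → EReal) (S : Set ℝ) (n : ℕ) (u : ℝ → ℝ) :
    Matrix (Fin n) (Fin n) ℝ :=
  Matrix.of fun i j => ∫ x in S, (orthoPoly W i * orthoPoly W j).eval x * u x

/-- The matrix integral `τ_n` as a determinant in the orthonormal polynomials of any weight. -/
theorem tau_eq_det_gramMatrix {W' : ℝ → EReal} (hpos : ∀ p : ℝ[X], p ≠ 0 → 0 < polyInner W p p)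
    (hint : ∀ p : ℝ[X], Integrable fun x => p.eval x * weight W' x) (S : Set ℝ) (n : ℕ) :
    tau W' S n = ((∏ i : Fin n, (√(polyInner W (monicOP W i) (monicOP W i)))⁻¹)⁻¹) ^ 2 *
      (gramMatrix W S n (weight W')).det := by
  set a : Fin n → ℝ := fun i => (√(polyInner W (monicOP W i) (monicOP W i)))⁻¹ with ha
  have ha0 : ∏ i, a i ≠ 0 := Finset.prod_ne_zero_iff.2 fun i _ => (orthoPoly_coeff_pos hpos i).ne'
  -- Passing from powers to monic polynomials leaves the Vandermonde determinant unchanged;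
  -- normalisation only scales columns.
  have hdet : ∀ x : Fin n → ℝ, ∏ i : Fin n, ∏ j ∈ Finset.Ioi i, (x j - x i) =
      (∏ i, a i)⁻¹ * (Matrix.of fun i j : Fin n => (orthoPoly W j).eval (x i)).det := by
    intro x
    rw [← Matrix.det_vandermonde, Matrix.det_eval_matrixOfPolynomials_eq_det_vandermonde x
      (fun i : Fin n => monicOP W i) (fun i => monicOP_natDegree W i) fun i => monicOP_monic W i]
    have h := Matrix.det_mul_row a (Matrix.of fun i j : Fin n => (monicOP W j).eval (x i))
    have h2 : (Matrix.of fun i j : Fin n => (orthoPoly W j).eval (x i)) =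
        Matrix.of fun i j : Fin n =>
          a j * (Matrix.of fun i j : Fin n => (monicOP W j).eval (x i)) i j := by
      ext i j
      simp [orthoPoly, ha]
    rw [h2, h, inv_mul_cancel_left₀ ha0]
  have hand := integral_det_sq_mul_prod (n := n) (volume.restrict S)
    (fun i x => (orthoPoly W i).eval x) (weight W') fun i j => by
      simpa using (hint (orthoPoly W i * orthoPoly W j)).restrict (s := S)
  rw [tau, volume_pi, Measure.restrict_pi_pi]
  simp_rw [hdet, mul_pow, mul_assoc]
  rw [integral_const_mul, hand]
  have hn : (n ! : ℝ) ≠ 0 := by exact_mod_cast n.factorial_ne_zero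
  simp only [gramMatrix, eval_mul]
  field_simp

variable (hint : ∀ p : ℝ[X], Integrable fun x => p.eval x * weight W x)
  (hpos : ∀ p : ℝ[X], p ≠ 0 → 0 < polyInner W p p)

include hint hpos

theorem gramMatrix_univ (n : ℕ) : gramMatrix W Set.univ n (weight W) = 1 := by
  ext i j
  rw [gramMatrix, Matrix.of_apply, setIntegral_univ, ← polyInner_eq_integral,
    polyInner_orthoPoly hint hpos, Matrix.one_apply]
  simp [Fin.ext_iff]

/-- The quadratic form of the Gram matrix at `v` is the integral of `q²` against the weight over
`S`, with `q = ∑ v_i π_i`. This positivity yields both the invertibility of `I - K_n^J` and `τ > 0`.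
-/
theorem det_gramMatrix_pos {S : Set ℝ} (hS : volume (S ∩ {x | 0 < weight W x}) ≠ 0) (n : ℕ) :
    0 < (gramMatrix W S n (weight W)).det := by
  refine Matrix.PosDef.det_pos (Matrix.PosDef.of_dotProduct_mulVec_pos ?_ fun v hv => ?_)
  · ext i j
    simp [gramMatrix, mul_comm]
  set q : ℝ[X] := ∑ i : Fin n, C (v i) * orthoPoly W i with hq
  have hq0 : q ≠ 0 := by
    rintro h0
    refine hv (funext fun k => ?_)
    have h : polyInner W q (orthoPoly W k) = v k := by
      rw [hq, polyInner_sum_left hint, Finset.sum_eq_single k]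
      · simp [polyInner_C_mul_left, polyInner_orthoPoly hint hpos]
      · intro i _ hi
        simp [polyInner_C_mul_left, polyInner_orthoPoly hint hpos, Fin.val_ne_iff.2 hi]
      · simp
    rw [← h, h0]
    simp [polyInner]
  have hval : star v ⬝ᵥ (gramMatrix W S n (weight W)).mulVec v =
      ∫ x in S, (q * q).eval x * weight W x := by
    have h : ∀ x, (q * q).eval x * weight W x = ∑ i : Fin n, ∑ j : Fin n,
        v i * v j * ((orthoPoly W i * orthoPoly W j).eval x * weight W x) := fun x => by
      rw [eval_mul, hq, eval_finsetSum, Finset.sum_mul_sum, Finset.sum_mul]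
      refine Finset.sum_congr rfl fun i _ => ?_
      rw [Finset.sum_mul]
      refine Finset.sum_congr rfl fun j _ => ?_
      simp only [eval_mul, eval_C]
      ring
    simp_rw [h]
    rw [integral_finsetSum _ fun i _ => integrable_finsetSum _ fun j _ =>
      ((hint _).restrict).const_mul _]
    simp_rw [integral_finsetSum _ fun j _ => ((hint _).restrict (s := S)).const_mul _,
      integral_const_mul]
    simp only [dotProduct, Matrix.mulVec, gramMatrix, Matrix.of_apply, Finset.mul_sum, star_trivial]
    refine Finset.sum_congr rfl fun i _ => Finset.sum_congr rfl fun j _ => by ring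
  rw [hval]
  exact setIntegral_sq_eval_pos (weight_nonneg W) hS hq0 (hint _)

/-- Multiplication by `x` in the Gram matrix, through the truncated Jacobi matrix. -/
theorem gramMatrix_X_mul (S : Set ℝ) (m : ℕ) :
    (Matrix.of fun i j : Fin (m + 1) =>
      ∫ x in S, (X * (orthoPoly W i * orthoPoly W j) : ℝ[X]).eval x * weight W x) =
    (Matrix.of fun i k : Fin (m + 1) => polyInner W (X * orthoPoly W i) (orthoPoly W k)) *
      gramMatrix W S (m + 1) (weight W) +
    Matrix.vecMulVec (Pi.single (Fin.last m) (recB W m)) (fun j : Fin (m + 1) =>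
      ∫ x in S, (orthoPoly W (m + 1) * orthoPoly W j).eval x * weight W x) := by
  ext i j
  have h : ∀ x, (X * (orthoPoly W i * orthoPoly W j) : ℝ[X]).eval x * weight W x =
      (∑ k : Fin (m + 1), polyInner W (X * orthoPoly W i) (orthoPoly W k) *
        ((orthoPoly W k * orthoPoly W j).eval x * weight W x)) +
      (Pi.single (Fin.last m) (recB W m) : Fin (m + 1) → ℝ) i *
        ((orthoPoly W (m + 1) * orthoPoly W j).eval x * weight W x) := fun x => by
    have hc : (if (i : ℕ) + 1 = m + 1 then recB W i else 0) =
        (Pi.single (Fin.last m) (recB W m) : Fin (m + 1) → ℝ) i := by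
      by_cases hi : i = Fin.last m
      · subst hi; simp
      · rw [Pi.single_eq_of_ne hi, if_neg]
        simpa [Fin.ext_iff] using hi
    have hX := congrArg (eval x) (X_mul_orthoPoly hint hpos i.isLt)
    rw [hc, Finset.sum_range, eval_add, eval_finsetSum] at hX
    rw [← mul_assoc, eval_mul, hX, add_mul, add_mul, Finset.sum_mul, Finset.sum_mul]
    simp only [eval_mul, eval_C, mul_assoc]
  simp only [Matrix.add_apply, Matrix.mul_apply, Matrix.of_apply, Matrix.vecMulVec_apply,
    gramMatrix]
  simp_rw [h]
  rw [integral_add (integrable_finsetSum _ fun k _ => ((hint _).restrict).const_mul _)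
    (((hint _).restrict).const_mul _), integral_finsetSum _ fun k _ =>
    ((hint _).restrict).const_mul _]
  simp_rw [integral_const_mul]

omit hpos in
theorem memLp_phi (k : ℕ) (S : Set ℝ) : MemLp (phi W k) 2 (volume.restrict S) := by
  have hw : AEStronglyMeasurable (weight W) volume := by
    simpa using (hint 1).aestronglyMeasurable
  have hm : AEStronglyMeasurable (phi W k) volume :=
    (orthoPoly W k).continuous.aestronglyMeasurable.mul
      (Real.continuous_sqrt.comp_aestronglyMeasurable hw)
  refine (memLp_two_iff_integrable_sq hm.restrict).2 (Integrable.restrict ?_)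
  refine (hint (orthoPoly W k * orthoPoly W k)).congr (Eventually.of_forall fun x => ?_)
  simp only [phi, eval_mul, mul_pow, Real.sq_sqrt (weight_nonneg W x)]
  ring

/-- Orthonormality on `ℝ` trades integrals over `Jᶜ` for integrals over `J`, where `τ_n^J` lives. -/
theorem inner_toL2c_phi {J : Set ℝ} (hJ : MeasurableSet J) (k l : ℕ) :
    ⟪toL2c J (phi W k), toL2c J (phi W l)⟫ = (if k = l then 1 else 0) -
      ∫ x in J, (orthoPoly W k * orthoPoly W l).eval x * weight W x := by
  have h : ⟪toL2c J (phi W k), toL2c J (phi W l)⟫ =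
      ∫ x in Jᶜ, (orthoPoly W k * orthoPoly W l).eval x * weight W x := by
    rw [L2.inner_def]
    refine integral_congr_ae ?_
    filter_upwards [toL2c_coeFn (memLp_phi hint k Jᶜ), toL2c_coeFn (memLp_phi hint l Jᶜ)]
      with x hk hl
    simp only [hk, hl, phi, eval_mul]
    simp only [RCLike.inner_apply, conj_trivial]
    linear_combination (orthoPoly W k).eval x * (orthoPoly W l).eval x *
      sqrt_weight_mul_self (W := W) x
  rw [h, ← polyInner_orthoPoly hint hpos, polyInner_eq_integral,
    ← integral_add_compl hJ (hint (orthoPoly W k * orthoPoly W l))]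
  ring

omit hint hpos in
theorem toL2c_const_mul {J : Set ℝ} {f : ℝ → ℝ} (c : ℝ)
    (hf : MemLp f 2 (volume.restrict Jᶜ)) : toL2c J (fun x => c * f x) = c • toL2c J f := by
  rw [toL2c, toL2c, dif_pos hf, dif_pos (hf.const_mul c)]
  rfl

omit hint hpos in
theorem opK_eq_gramOp (W : ℝ → EReal) (J : Set ℝ) (n : ℕ) :
    opK W J n = gramOp fun k : Fin n => toL2c J (phi W k) := by
  rw [opK, gramOp, Finset.sum_range]

theorem gramMatrix_eq_one_sub_inner {J : Set ℝ} (hJ : MeasurableSet J) {n : ℕ} (i j : Fin n) :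
    gramMatrix W J n (weight W) i j = (1 : Matrix (Fin n) (Fin n) ℝ) i j -
      ⟪toL2c J (phi W i), toL2c J (phi W j)⟫ := by
  rw [inner_toL2c_phi hint hpos hJ, Matrix.one_apply, gramMatrix, Matrix.of_apply]
  simp [Fin.ext_iff]

theorem isUnit_one_sub_opK {J : Set ℝ} (hJ : MeasurableSet J)
    (hJpos : volume (J ∩ {x | 0 < weight W x}) ≠ 0) (n : ℕ) : IsUnit (1 - opK W J n) := by
  rw [opK_eq_gramOp]
  exact isUnit_one_sub_gramOp (gramMatrix_eq_one_sub_inner hint hpos hJ)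
    (det_gramMatrix_pos hint hpos hJpos n).ne'

/-- The inner product `v_n` in terms of Gram matrices over `J`. -/
theorem innerV_eq {J : Set ℝ} (hJ : MeasurableSet J)
    (hJpos : volume (J ∩ {x | 0 < weight W x}) ≠ 0) (m : ℕ) :
    innerV W J (m + 1) = -∑ k : Fin (m + 1),
      (gramMatrix W J (m + 1) (weight W))⁻¹ k (Fin.last m) * recB W m *
        ∫ x in J, (orthoPoly W (m + 1) * orthoPoly W k).eval x * weight W x := by
  rw [innerV, bigPhi, bigPsi, resolvent, opK_eq_gramOp, Nat.add_sub_cancel,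
    toL2c_const_mul _ (memLp_phi hint _ _), toL2c_const_mul _ (memLp_phi hint _ _), map_smul,
    inner_smul_left, inner_smul_right]
  have h := inverse_one_sub_gramOp_apply (gramMatrix_eq_one_sub_inner hint hpos hJ)
    (det_gramMatrix_pos hint hpos hJpos (m + 1)).ne' (Fin.last m)
  rw [Fin.val_last] at h
  rw [h, inner_sum, ← mul_assoc, conj_trivial, Real.mul_self_sqrt (recB_nonneg hint hpos m),
    Finset.mul_sum, ← Finset.sum_neg_distrib]
  refine Finset.sum_congr rfl fun k _ => ?_
  -- Since `k < m + 1`, the Kronecker delta vanishes; this is the source of the minus sign.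
  rw [inner_smul_right, inner_toL2c_phi hint hpos hJ, if_neg k.isLt.ne']
  ring

end GramMatrices

/-! ### The logarithmic derivative and the return to `τ`. -/

theorem log_det_gramMatrix_hasDerivAt {W : ℝ → EReal}
    (hexp : ∀ᶠ s in 𝓝 (0 : ℝ), Integrable (fun x => weight W x * Real.exp (s * x)))
    (hpos : ∀ p : ℝ[X], p ≠ 0 → 0 < polyInner W p p) {J : Set ℝ} (hJ : MeasurableSet J)
    (hJpos : volume (J ∩ {x | 0 < weight W x}) ≠ 0) (m : ℕ) :
    HasDerivAt (fun s : ℝ => Real.log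
      ((gramMatrix W J (m + 1) fun x => weight W x * Real.exp (s * x)).det /
        (gramMatrix W Set.univ (m + 1) fun x => weight W x * Real.exp (s * x)).det))
      (-innerV W J (m + 1)) 0 := by
  have hint : ∀ p : ℝ[X], Integrable fun x => p.eval x * weight W x := by
    simpa using (eventually_integrable_eval_mul_exp (weight_nonneg W) hexp).self_of_nhds
  have hzero : ∀ S, (gramMatrix W S (m + 1) fun x => weight W x * Real.exp (0 * x)) =
      gramMatrix W S (m + 1) (weight W) := fun S => by simp
  have hd : ∀ S, (gramMatrix W S (m + 1) (weight W)).det ≠ 0 → HasDerivAt (fun s : ℝ =>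
      (gramMatrix W S (m + 1) fun x => weight W x * Real.exp (s * x)).det)
      ((gramMatrix W S (m + 1) (weight W)).det * ((gramMatrix W S (m + 1) (weight W))⁻¹ *
        Matrix.of fun i j : Fin (m + 1) =>
          ∫ x in S, (X * (orthoPoly W i * orthoPoly W j) : ℝ[X]).eval x * weight W x).trace) 0 := by
    intro S h0
    have h := hasDerivAt_det
      (M := fun s => gramMatrix W S (m + 1) fun x => weight W x * Real.exp (s * x)) (s := 0)
      (M' := Matrix.of fun i j : Fin (m + 1) =>
          ∫ x in S, (X * (orthoPoly W i * orthoPoly W j) : ℝ[X]).eval x * weight W x)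
      (by rwa [hzero]) fun i j =>
        hasDerivAt_integral_eval_mul_exp (weight_nonneg W)
          (hexp.mono fun s hs => hs.restrict) (orthoPoly W i * orthoPoly W j)
    rwa [hzero] at h
  have hdJ := (det_gramMatrix_pos hint hpos hJpos (m + 1)).ne'
  have hdR : (gramMatrix W Set.univ (m + 1) (weight W)).det ≠ 0 := by
    simp [gramMatrix_univ hint hpos]
  have h := ((hd J hdJ).div (hd Set.univ hdR) (by rwa [hzero])).log
    (by simp only [Pi.div_apply, hzero]; exact div_ne_zero hdJ hdR)
  refine h.congr_deriv ?_
  simp only [Pi.div_apply, hzero]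
  rw [gramMatrix_X_mul hint hpos, gramMatrix_X_mul hint hpos, gramMatrix_univ hint hpos]
  have hu : (fun j : Fin (m + 1) => ∫ x in Set.univ,
      (orthoPoly W (m + 1) * orthoPoly W j).eval x * weight W x) = 0 := by
    funext j
    rw [setIntegral_univ, ← polyInner_eq_integral, polyInner_orthoPoly hint hpos,
      if_neg j.isLt.ne']
    rfl
  -- By cyclicity, `tr(A⁻¹ Q A) = tr Q`, which cancels the trace over the whole line.
  rw [hu, innerV_eq hint hpos hJ hJpos, Matrix.mul_add, Matrix.trace_add, Matrix.trace_mul_comm,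
    Matrix.mul_assoc, Matrix.mul_nonsing_inv _ (isUnit_iff_ne_zero.2 hdJ)]
  set A := gramMatrix W J (m + 1) (weight W)
  have htr : ∀ u : Fin (m + 1) → ℝ,
      (A⁻¹ * Matrix.vecMulVec (Pi.single (Fin.last m) (recB W m)) u).trace =
        ∑ k, A⁻¹ k (Fin.last m) * recB W m * u k := by
    intro u
    simp [Matrix.trace, Matrix.mul_apply, Matrix.vecMulVec_apply, Pi.single_apply, mul_assoc]
  rw [htr]
  generalize (∑ k : Fin (m + 1), A⁻¹ k (Fin.last m) * recB W m *
    ∫ x in J, (orthoPoly W (m + 1) * orthoPoly W k).eval x * weight W x) = v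
  simp only [Matrix.det_one, inv_one, one_mul, mul_one, Matrix.vecMulVec_zero,
    add_zero, one_pow, div_one, neg_neg]
  field_simp
  ring

/-- Everything about the deformed ensemble at one admissible sequence of times. -/
theorem innerV_eq_neg_deriv_log_tau {V : ℝ → EReal} (hV : ∀ x, V x ≠ ⊥)
    {J : Set ℝ} (hJ : MeasurableSet J) (hpos : volume (J ∩ {x | V x ≠ ⊤}) ≠ 0)
    {n : ℕ} (hn : 1 ≤ n) {t : ℕ+ → ℝ} (ht : Admissible V t) :
    IsUnit (1 - opK (toda V t) J n) ∧ 0 < tau (toda V t) J n ∧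
      0 < tau (toda V t) Set.univ n ∧
      innerV (toda V t) J n =
        ⟪bigPsi (toda V t) J n, resolvent (toda V t) J n (bigPhi (toda V t) J n)⟫ ∧
      HasDerivAt (fun s : ℝ => Real.log (tau (toda V (Function.update t 1 s)) J n /
        tau (toda V (Function.update t 1 s)) Set.univ n)) (-innerV (toda V t) J n) (t 1) := by
  obtain ⟨hsum, hadm⟩ := ht
  set W := toda V t with hW
  have hae : ∀ s : ℝ, weight (toda V (Function.update t 1 (t 1 + s))) =ᵐ[volume]
      fun x => weight W x * Real.exp (s * x) := fun s => by
    filter_upwards [hsum] with x hx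
    rw [weight_toda_update t _ (hV x) hx, add_sub_cancel_left]
  have htend : Tendsto (fun s : ℝ => t 1 + s) (𝓝 0) (𝓝 (t 1)) := by
    simpa using (continuous_const_add (t 1)).tendsto 0
  have hexp : ∀ᶠ s in 𝓝 (0 : ℝ), Integrable (fun x => weight W x * Real.exp (s * x)) := by
    filter_upwards [htend.eventually hadm] with s hs using hs.congr (hae s)
  have hints := eventually_integrable_eval_mul_exp (weight_nonneg W) hexp
  have hint : ∀ p : ℝ[X], Integrable fun x => p.eval x * weight W x := by
    simpa using hints.self_of_nhds
  have hsub : {x | V x ≠ ⊤} ⊆ {x | 0 < weight W x} := fun x hx => weight_toda_pos t (hV x) hx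
  have hJpos : volume (J ∩ {x | 0 < weight W x}) ≠ 0 := fun h =>
    hpos (measure_mono_null (Set.inter_subset_inter_right _ hsub) h)
  have hRpos : volume (Set.univ ∩ {x | 0 < weight W x}) ≠ 0 := fun h =>
    hJpos (measure_mono_null (Set.inter_subset_inter_left _ (Set.subset_univ _)) h)
  have hpp : ∀ p : ℝ[X], p ≠ 0 → 0 < polyInner W p p := fun p hp => by
    rw [polyInner_eq_integral, ← setIntegral_univ]
    exact setIntegral_sq_eval_pos (weight_nonneg W) hRpos hp (hint _)
  have hc : 0 < ((∏ i : Fin n, (√(polyInner W (monicOP W i) (monicOP W i)))⁻¹)⁻¹) ^ 2 := by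
    refine pow_pos (inv_pos.2 (Finset.prod_pos fun i _ => ?_)) 2
    exact orthoPoly_coeff_pos hpp i
  have hunit := isUnit_one_sub_opK hint hpp hJ hJpos n
  refine ⟨hunit, ?_, ?_, ?_, ?_⟩
  · rw [tau_eq_det_gramMatrix hpp hint]
    exact mul_pos hc (det_gramMatrix_pos hint hpp hJpos n)
  · rw [tau_eq_det_gramMatrix hpp hint]
    exact mul_pos hc (det_gramMatrix_pos hint hpp hRpos n)
  · rw [innerV, resolvent]
    rw [opK_eq_gramOp] at hunit ⊢
    exact inner_inverse_one_sub_gramOp_comm hunit _ _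
  · obtain ⟨m, rfl⟩ : ∃ m, n = m + 1 := ⟨n - 1, by omega⟩
    have hd := log_det_gramMatrix_hasDerivAt hexp hpp hJ hJpos m
    -- The basis stays that of the unperturbed `W`, so the prefactor is independent of `s` and of
    -- the domain, and cancels.
    have hratio : (fun s => Real.log (tau (toda V (Function.update t 1 (t 1 + s))) J (m + 1) /
        tau (toda V (Function.update t 1 (t 1 + s))) Set.univ (m + 1))) =ᶠ[𝓝 0]
        fun s : ℝ => Real.log
          ((gramMatrix W J (m + 1) fun x => weight W x * Real.exp (s * x)).det /
            (gramMatrix W Set.univ (m + 1) fun x => weight W x * Real.exp (s * x)).det) := by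
      filter_upwards [hints] with s hs
      have hi : ∀ p : ℝ[X], Integrable fun x =>
          p.eval x * weight (toda V (Function.update t 1 (t 1 + s))) x := fun p =>
        (hs p).congr ((hae s).mono fun x hx => by simp only [hx])
      have hg : ∀ S, gramMatrix W S (m + 1) (weight (toda V (Function.update t 1 (t 1 + s)))) =
          gramMatrix W S (m + 1) fun x => weight W x * Real.exp (s * x) := fun S => by
        ext i j
        exact integral_congr_ae (ae_restrict_of_ae ((hae s).mono fun x hx => by simp only [hx]))
      rw [tau_eq_det_gramMatrix hpp hi, tau_eq_det_gramMatrix hpp hi, hg, hg,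
        mul_div_mul_left _ _ hc.ne']
    have h := hd.congr_of_eventuallyEq hratio
    rw [← sub_self (t 1)] at h
    have h' := h.comp_sub_const (t 1) (t 1)
    simpa using h'

end UnitaryEnsemble

theorem theorem4 (V : ℝ → EReal) (hVm : Measurable V) (hV : ∀ x, V x ≠ ⊥)
    (J : Set ℝ) (hJ : MeasurableSet J) (hpos : volume (J ∩ {x | V x ≠ ⊤}) ≠ 0)
    (n : ℕ) (hn : 1 ≤ n) :
    (∀ t : ℕ+ → ℝ, UnitaryEnsemble.Admissible V t →
      IsUnit (1 - UnitaryEnsemble.opK (UnitaryEnsemble.toda V t) J n) ∧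
      0 < UnitaryEnsemble.tau (UnitaryEnsemble.toda V t) J n ∧
      0 < UnitaryEnsemble.tau (UnitaryEnsemble.toda V t) Set.univ n ∧
      UnitaryEnsemble.innerV (UnitaryEnsemble.toda V t) J n =
        inner ℝ (UnitaryEnsemble.bigPsi (UnitaryEnsemble.toda V t) J n)
          (UnitaryEnsemble.resolvent (UnitaryEnsemble.toda V t) J n
            (UnitaryEnsemble.bigPhi (UnitaryEnsemble.toda V t) J n)) ∧
      HasDerivAt
        (fun s : ℝ => Real.log
          (UnitaryEnsemble.tau (UnitaryEnsemble.toda V (Function.update t 1 s)) J n /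
            UnitaryEnsemble.tau (UnitaryEnsemble.toda V (Function.update t 1 s)) Set.univ n))
        (-UnitaryEnsemble.innerV (UnitaryEnsemble.toda V t) J n) (t 1)) ∧
    (UnitaryEnsemble.Admissible V 0 →
      IsUnit (1 - UnitaryEnsemble.opK V J n) ∧
      0 < UnitaryEnsemble.tau V J n ∧
      0 < UnitaryEnsemble.tau V Set.univ n ∧
      UnitaryEnsemble.innerV V J n =
        inner ℝ (UnitaryEnsemble.bigPsi V J n)
          (UnitaryEnsemble.resolvent V J n (UnitaryEnsemble.bigPhi V J n)) ∧
      HasDerivAt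
        (fun s : ℝ => Real.log
          (UnitaryEnsemble.tau (UnitaryEnsemble.toda V (Function.update 0 1 s)) J n /
            UnitaryEnsemble.tau (UnitaryEnsemble.toda V (Function.update 0 1 s)) Set.univ n))
        (-UnitaryEnsemble.innerV V J n) 0) := by
  have key := fun (t : ℕ+ → ℝ) (ht : UnitaryEnsemble.Admissible V t) =>
    UnitaryEnsemble.innerV_eq_neg_deriv_log_tau hV hJ hpos hn ht
  refine ⟨key, fun h0 => ?_⟩
  have h := key 0 h0
  rwa [UnitaryEnsemble.toda_zero] at h
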